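/- Let $d\ge 2$ be a square-free integer. Let $T$ be an interval exchange transformation on $[\ell,r[$ with exchanged semi-intervals $I_1,\dots,I_s$ (from left to right) of positive lengths $\lambda_1,\dots,\lambda_s$ and permutation $\pi$; that is, $T(z)=z+\delta_i-\gamma_i$ for $z\in I_i=[\gamma_i,\gamma_i+\lambda_i[$, where $\gamma_i=\ell+\sum_{j<i}\lambda_j$, $\delta_i=\ell+\sum_{\pi(j)<\pi(i)}\lambda_j$ and $r=\ell+\sum_j\lambda_j$. Assume that $T$ is minimal (every orbit $\{T^n(z)\mid n\in\mathbb Z\}$ is dense in $[\ell,r[$) and normalized over $\mathbb Z[\sqrt d]$, i.e. $\ell,\lambda_1,\dots,\lambda_s\in\mathbb Z[\sqrt d]$. For $\ell\le u<v\le r$ and $z\in[\ell,r[$ put $\rho^+(z)=\min\{n>0\mid T^n(z)\in\,]u,v[\}$ and $\rho^-(z)=\min\{n\ge0\mid T^{-n}(z)\in\,]u,v[\}$. The semi-interval $J=[u,v[$ is admissible for $T$ if each of $u,v$ either equals $r$ or is of the form $T^k(\gamma_i)$ with $1\le i\le s$ and $-\rho^-(\gamma_i)\le k<\rho^+(\gamma_i)$.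 For $m,n\in\mathbb Z$ put $\Psi(m+n\sqrt d)=\max(|m|,|n|)$. For a finite union $S\subset[\ell,r[$ of semi-intervals with endpoints in $\mathbb Z[\sqrt d]$, let $\Psi(S)$ be the maximum of $\Psi$ over the boundary points of $S$, and let $\Pi(S)=|S|\,\Psi(S)$, where $|S|$ is the Lebesgue measure of $S$. Then every semi-interval $J$ admissible for $T$ has its endpoints in $\mathbb Z[\sqrt d]$, and $\Pi(J)=\Theta(1)$: there are constants $c,C>0$, depending only on $T$, such that $c\le\Pi(J)\le C$ for every semi-interval $J$ admissible for $T$. -/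

import Mathlib

open Set

noncomputable section

/-- The combinatorial data of an interval exchange transformation of `s ≥ 1` semi-intervals:
the left endpoint `l` of the domain, the positive lengths of the exchanged semi-intervals,
listed from left to right, and the permutation describing the order of their images. -/
structure IET (s : ℕ) where
  size_pos : 0 < s
  l : ℝ
  len : Fin s → ℝ
  len_pos : ∀ i, 0 < len i
  perm : Equiv.Perm (Fin s)

namespace IET

variable {s : ℕ} (T : IET s)

/-- The right endpoint of the domain. -/
def r : ℝ := T.l + ∑ i, T.len i

/-- The domain `[l, r[`. -/
abbrev Domain : Type := Set.Ico T.l T.r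

/-- The left endpoint of the `i`-th semi-interval when the semi-intervals are laid side by side
from `l` in the order given by `σ`, i.e. `j` is to the left of `i` when `σ j < σ i`. -/
def leftEnd (σ : Equiv.Perm (Fin s)) (i : Fin s) : ℝ :=
  T.l + ∑ j ∈ Finset.univ.filter (fun j => σ j < σ i), T.len j

/-- The left endpoint of the `i`-th exchanged semi-interval `I_i = [γ_i, γ_i + λ_i[`. -/
def gamma (i : Fin s) : ℝ := T.l + ∑ j ∈ Finset.univ.filter (fun j => j < i), T.len j

/-- The left endpoint of the image `J_i = [δ_i, δ_i + λ_i[` of `I_i`. -/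
def delta (i : Fin s) : ℝ :=
  T.l + ∑ j ∈ Finset.univ.filter (fun j => T.perm j < T.perm i), T.len j

/-- The translation value of the `i`-th exchanged semi-interval. -/
def alpha (i : Fin s) : ℝ := T.delta i - T.gamma i

/-- The `i`-th exchanged semi-interval. -/
def piece (i : Fin s) : Set ℝ := Set.Ico (T.gamma i) (T.gamma i + T.len i)

theorem gamma_eq (i : Fin s) : T.gamma i = T.leftEnd 1 i := rfl

theorem delta_eq (i : Fin s) : T.delta i = T.leftEnd T.perm i := rfl

theorem l_le_leftEnd (σ : Equiv.Perm (Fin s)) (i : Fin s) : T.l ≤ T.leftEnd σ i := by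
  have := Finset.sum_nonneg (s := Finset.univ.filter (fun j => σ j < σ i))
    (fun j _ => (T.len_pos j).le)
  unfold leftEnd
  linarith

theorem leftEnd_add (σ : Equiv.Perm (Fin s)) (i : Fin s) :
    T.leftEnd σ i + T.len i
      = T.l + ∑ j ∈ Finset.univ.filter (fun j => σ j ≤ σ i), T.len j := by
  have h : Finset.univ.filter (fun j => σ j ≤ σ i)
      = insert i (Finset.univ.filter (fun j => σ j < σ i)) := by
    ext j
    simp only [Finset.mem_filter, Finset.mem_univ, true_and, Finset.mem_insert]
    rw [le_iff_eq_or_lt, σ.injective.eq_iff]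
  rw [h, Finset.sum_insert (by simp)]
  unfold leftEnd
  ring

theorem leftEnd_add_le_r (σ : Equiv.Perm (Fin s)) (i : Fin s) :
    T.leftEnd σ i + T.len i ≤ T.r := by
  rw [leftEnd_add]
  unfold r
  have := Finset.sum_le_sum_of_subset_of_nonneg
    (Finset.filter_subset (fun j => σ j ≤ σ i) Finset.univ)
    (fun j _ _ => (T.len_pos j).le)
  linarith

theorem leftEnd_add_le_of_lt (σ : Equiv.Perm (Fin s)) {i j : Fin s} (h : σ i < σ j) :
    T.leftEnd σ i + T.len i ≤ T.leftEnd σ j := by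
  rw [leftEnd_add]
  unfold leftEnd
  have := Finset.sum_le_sum_of_subset_of_nonneg (f := T.len)
    (s := Finset.univ.filter (fun k => σ k ≤ σ i))
    (t := Finset.univ.filter (fun k => σ k < σ j))
    (fun k hk => by
      simp only [Finset.mem_filter, Finset.mem_univ, true_and] at hk ⊢
      exact lt_of_le_of_lt hk h)
    (fun k _ _ => (T.len_pos k).le)
  linarith

/-- The semi-intervals laid side by side in any order form a partition of the domain. -/
theorem existsUnique_mem (σ : Equiv.Perm (Fin s)) {z : ℝ} (hz : z ∈ Set.Ico T.l T.r) :
    ∃! i, z ∈ Set.Ico (T.leftEnd σ i) (T.leftEnd σ i + T.len i) := by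
  have key : ∃ i, z ∈ Set.Ico (T.leftEnd σ i) (T.leftEnd σ i + T.len i) := by
    have hne : (Finset.univ.filter (fun i => T.leftEnd σ i ≤ z)).Nonempty := by
      refine ⟨σ.symm ⟨0, T.size_pos⟩, ?_⟩
      simp only [Finset.mem_filter, Finset.mem_univ, true_and]
      unfold leftEnd
      rw [Finset.filter_eq_empty_iff.2]
      · simpa using hz.1
      · intro j _
        simp [Fin.lt_def]
    obtain ⟨i, hi, hmax⟩ := Finset.exists_max_image _ σ hne
    simp only [Finset.mem_filter, Finset.mem_univ, true_and] at hi hmax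
    refine ⟨i, hi, ?_⟩
    by_contra hcon
    push Not at hcon
    by_cases hlast : (σ i).val + 1 < s
    · have hnext := hmax (σ.symm ⟨(σ i).val + 1, hlast⟩) (by
        refine le_trans (le_of_eq ?_) hcon
        rw [leftEnd_add]
        unfold leftEnd
        congr 2
        ext j
        simp only [Equiv.apply_symm_apply, Finset.mem_filter, Finset.mem_univ, true_and,
          Fin.lt_def, Fin.le_def]
        omega)
      simp only [Equiv.apply_symm_apply, Fin.le_def] at hnext
      omega
    · have hall : T.leftEnd σ i + T.len i = T.r := by
        rw [leftEnd_add, Finset.filter_true_of_mem]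
        · rfl
        · intro j _
          have := (σ j).isLt
          rw [Fin.le_def]
          omega
      have := hz.2
      linarith
  obtain ⟨i, hi⟩ := key
  refine ⟨i, hi, fun j hj => ?_⟩
  by_contra hne
  rcases lt_or_gt_of_ne (fun h => hne (σ.injective h) : σ j ≠ σ i) with h | h
  · have := T.leftEnd_add_le_of_lt σ h
    have := hi.1
    have := hj.2
    linarith
  · have := T.leftEnd_add_le_of_lt σ h
    have := hj.1
    have := hi.2
    linarith

theorem exists_mem_piece (z : T.Domain) : ∃ i, (z : ℝ) ∈ T.piece i :=
  (T.existsUnique_mem 1 z.2).exists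

/-- The index of the exchanged semi-interval that contains `z`. -/
def idx (z : T.Domain) : Fin s := (T.exists_mem_piece z).choose

theorem mem_piece_idx (z : T.Domain) : (z : ℝ) ∈ T.piece (T.idx z) :=
  (T.exists_mem_piece z).choose_spec

theorem image_mem (z : T.Domain) :
    (z : ℝ) + T.alpha (T.idx z)
      ∈ Set.Ico (T.delta (T.idx z)) (T.delta (T.idx z) + T.len (T.idx z)) := by
  have h := T.mem_piece_idx z
  unfold piece at h
  unfold alpha
  constructor
  · linarith [h.1]
  · linarith [h.2]

/-- The interval exchange transformation as a map: `T z = z + α_i` if `z ∈ I_i`. -/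
def toFun (z : T.Domain) : T.Domain :=
  ⟨z + T.alpha (T.idx z),
    le_trans (T.l_le_leftEnd T.perm _) (T.image_mem z).1,
    lt_of_lt_of_le (T.image_mem z).2 (T.leftEnd_add_le_r T.perm _)⟩

theorem toFun_bijective : Function.Bijective T.toFun := by
  constructor
  · intro z w h
    have hv : (z : ℝ) + T.alpha (T.idx z) = w + T.alpha (T.idx w) := congrArg Subtype.val h
    have hi : T.idx z = T.idx w := by
      refine (T.existsUnique_mem T.perm (T.toFun z).2).unique (T.image_mem z) ?_
      rw [h]
      exact T.image_mem w
    rw [hi] at hv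
    exact Subtype.ext (by linarith)
  · intro y
    obtain ⟨i, hi, -⟩ := T.existsUnique_mem T.perm y.2
    rw [← delta_eq] at hi
    have hz : (y : ℝ) - T.alpha i ∈ T.piece i := by
      unfold alpha piece
      constructor
      · linarith [hi.1]
      · linarith [hi.2]
    let z : T.Domain := ⟨y - T.alpha i, le_trans (T.l_le_leftEnd 1 i) hz.1,
      lt_of_lt_of_le hz.2 (T.leftEnd_add_le_r 1 i)⟩
    have hidx : T.idx z = i := (T.existsUnique_mem 1 z.2).unique (T.mem_piece_idx z) hz
    refine ⟨z, Subtype.ext ?_⟩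
    change (y : ℝ) - T.alpha i + T.alpha (T.idx z) = y
    rw [hidx]
    ring

/-- The interval exchange transformation as a bijection of its domain. -/
def map : Equiv.Perm T.Domain := Equiv.ofBijective T.toFun T.toFun_bijective

/-- The separation points `γ_i` as points of the domain. -/
def sep (i : Fin s) : T.Domain :=
  ⟨T.gamma i, T.l_le_leftEnd 1 i,
    lt_of_lt_of_le (lt_add_of_pos_right _ (T.len_pos i)) (T.leftEnd_add_le_r 1 i)⟩

/-- The two-sided orbit of a point. -/
def orbit (z : T.Domain) : Set T.Domain := {w | ∃ n : ℤ, (T.map ^ n) z = w}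

/-- `T` is minimal: every (two-sided) orbit is dense in the domain. -/
def IsMinimal : Prop := ∀ z : T.Domain, Dense (T.orbit z)

/-- `min {n > 0 | T^n z ∈ ]u, v[}`. -/
def rhoPlus (u v : ℝ) (z : T.Domain) : ℕ :=
  sInf {n : ℕ | 0 < n ∧ ((T.map ^ (n : ℤ)) z : ℝ) ∈ Set.Ioo u v}

/-- `min {n ≥ 0 | T^{-n} z ∈ ]u, v[}`. -/
def rhoMinus (u v : ℝ) (z : T.Domain) : ℕ :=
  sInf {n : ℕ | ((T.map ^ (-(n : ℤ))) z : ℝ) ∈ Set.Ioo u v}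

/-- The neighbours of `z` with respect to the semi-interval `[u, v[`. -/
def neighbours (u v : ℝ) (z : T.Domain) : Set ℝ :=
  {x | ∃ k : ℤ, -(T.rhoMinus u v z : ℤ) ≤ k ∧ k < (T.rhoPlus u v z : ℤ) ∧
    x = ((T.map ^ k) z : ℝ)}

/-- The division points of `[u, v[` with respect to `T`. -/
def divisionPoints (u v : ℝ) : Set ℝ := ⋃ i : Fin s, T.neighbours u v (T.sep i)

/-- `J` is a semi-interval admissible for `T`. -/
def IsAdmissible (J : Set ℝ) : Prop :=
  ∃ u v : ℝ, T.l ≤ u ∧ u < v ∧ v ≤ T.r ∧ J = Set.Ico u v ∧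
    u ∈ T.divisionPoints u v ∪ {T.r} ∧ v ∈ T.divisionPoints u v ∪ {T.r}

end IET

/-- The inclusion of `ℤ[√d]` in the real numbers, `m + n √d`. -/
def zsqrtdVal (d : ℤ) (w : ℤ√d) : ℝ := w.re + w.im * Real.sqrt d

/-- The ring `ℤ[√d]` as a set of real numbers. -/
def zsqrtdReals (d : ℤ) : Set ℝ := Set.range (zsqrtdVal d)

/-- `Ψ(m + n √d) = max (|m|, |n|)` for real numbers of `ℤ[√d]`
(extended by `0` to the other real numbers). -/
def psi (d : ℤ) : ℝ → ℕ :=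
  Function.extend (zsqrtdVal d) (fun w => max w.re.natAbs w.im.natAbs) (fun _ => 0)

/-- The complexity `Ψ(S)`: the largest `Ψ(z)` for `z` in the boundary of `S`. -/
def complexity (d : ℤ) (S : Set ℝ) : ℕ := sSup (psi d '' frontier S)

/-- The reduced complexity `Π(S) = |S| Ψ(S)`. -/
def reducedComplexity (d : ℤ) (S : Set ℝ) : ℝ :=
  MeasureTheory.volume.real S * (complexity d S : ℝ)

namespace IET

variable {s : ℕ} (T : IET s)

/-- `T` is normalized over `ℤ[√d]`: the lengths of the exchanged semi-intervals and the left
endpoint of the domain are in `ℤ[√d]` (hence so are all `γ_i` and `α_i`). -/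
def IsNormalizedOver (d : ℤ) : Prop :=
  T.l ∈ zsqrtdReals d ∧ ∀ i, T.len i ∈ zsqrtdReals d

/-- The algebra of the subsets of `[l, r[` that are finite unions of semi-intervals with
endpoints in `ℤ[√d]`, on which the complexities are defined. -/
def algebraOver (d : ℤ) : Set (Set ℝ) :=
  {S | S ⊆ Set.Ico T.l T.r ∧ ∃ (n : ℕ) (a b : Fin n → ℝ),
    (∀ j, a j ∈ zsqrtdReals d ∧ b j ∈ zsqrtdReals d ∧ a j < b j) ∧
    S = ⋃ j, Set.Ico (a j) (b j)}

end IET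

end

/-!
The whole statement rests on the fact that a nonzero element of `ℤ[√d]` has norm at least `1` in
absolute value, so that it is at least of the order of the inverse of its height (the maximum of
the absolute values of its two coordinates): `one_le_abs_zsqrtdVal_mul`. Applied to the difference
of the endpoints, this is the lower bound for `Π(J)`.

For the upper bound, an endpoint `T^k(γ_i)` of `J = [u, v[` has height of the order of at most
`1 + |k|`, because each application of `T` or its inverse adds one of finitely many translations.
The orbit segment that joins it to `γ_i` avoids `]u, v[`, so it has to be shown that such a segment
has a length of order at most `1 / (v - u)`, that is, that `T` is linearly recurrent
(`IET.exists_avoidance_bound`). The interval `]u, v[` contains an interval `J'` with endpoints in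
`ℤ[√d]` of height of order `1 / (v - u)`; they are found by scaling with a unit of norm `1`
(`exists_zsqrtd_mem_Ioo`). Let `F_t` be the set of the points whose first `t + 1` iterates avoid
`J'`. It is cut out by points of height at most of the order of `1 / (v - u) + t`, and so is
`F_t \ F_{t+1}`. As points of bounded height are separated, if `F_t \ F_{t+1}` is nonempty it has
measure at least of the order of `1 / (1 / (v - u) + t)` (`IET.Adapted.le_lebesgue_real`). By
minimality and the invariance of the Lebesgue measure, it is nonempty whenever `F_t` is
(`IET.avoiding_diff_nonempty`). These sets are disjoint, and the sum of their measures over `t < k`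
is at least of the order of `log (1 + k (v - u))`. As it is at most `r - l`, the product
`k (v - u)` is bounded when `F_k` is nonempty (`IET.log_le_of_avoiding_nonempty`).
-/

open Set

noncomputable section

/-! ### Elements of `ℤ[√d]` of bounded height -/

/-- The height `max (|m|, |n|)` of `m + n √d`, as a real number. -/
def zsqrtdHeight {d : ℤ} (w : ℤ√d) : ℝ := max |(w.re : ℝ)| |(w.im : ℝ)|

section Arithmetic

variable {d : ℤ}

theorem zsqrtdHeight_nonneg (w : ℤ√d) : 0 ≤ zsqrtdHeight w :=
  (abs_nonneg _).trans (le_max_left _ _)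

theorem zsqrtdHeight_add_le (w z : ℤ√d) :
    zsqrtdHeight (w + z) ≤ zsqrtdHeight w + zsqrtdHeight z := by
  unfold zsqrtdHeight
  simp only [Zsqrtd.re_add, Zsqrtd.im_add, Int.cast_add]
  exact max_le ((abs_add_le _ _).trans (add_le_add (le_max_left _ _) (le_max_left _ _)))
    ((abs_add_le _ _).trans (add_le_add (le_max_right _ _) (le_max_right _ _)))

theorem zsqrtdHeight_neg (w : ℤ√d) : zsqrtdHeight (-w) = zsqrtdHeight w := by
  simp [zsqrtdHeight]

theorem zsqrtdHeight_sub_le (w z : ℤ√d) :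
    zsqrtdHeight (w - z) ≤ zsqrtdHeight w + zsqrtdHeight z := by
  rw [sub_eq_add_neg, ← zsqrtdHeight_neg z]
  exact zsqrtdHeight_add_le _ _

theorem zsqrtdVal_eq_toReal (hd : 0 ≤ d) (w : ℤ√d) :
    zsqrtdVal d w = Zsqrtd.toReal hd w := by
  simp [zsqrtdVal]

theorem zsqrtdVal_add (w z : ℤ√d) : zsqrtdVal d (w + z) = zsqrtdVal d w + zsqrtdVal d z := by
  simp [zsqrtdVal]; ring

theorem zsqrtdVal_sub (w z : ℤ√d) : zsqrtdVal d (w - z) = zsqrtdVal d w - zsqrtdVal d z := by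
  simp [zsqrtdVal]; ring

theorem zsqrtdVal_sum {ι : Type*} (S : Finset ι) (f : ι → ℤ√d) :
    zsqrtdVal d (∑ j ∈ S, f j) = ∑ j ∈ S, zsqrtdVal d (f j) := by
  classical
  induction S using Finset.induction_on with
  | empty => simp [zsqrtdVal]
  | insert a S ha ih => rw [Finset.sum_insert ha, Finset.sum_insert ha, zsqrtdVal_add, ih]

theorem abs_zsqrtdVal_le (w : ℤ√d) :
    |zsqrtdVal d w| ≤ zsqrtdHeight w * (1 + Real.sqrt d) := by
  unfold zsqrtdVal
  have h1 : |(w.re : ℝ)| ≤ zsqrtdHeight w := le_max_left _ _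
  have h2 : |(w.im : ℝ)| ≤ zsqrtdHeight w := le_max_right _ _
  have h3 := abs_add_le (w.re : ℝ) (w.im * Real.sqrt d)
  rw [abs_mul, abs_of_nonneg (Real.sqrt_nonneg d)] at h3
  have h4 := mul_le_mul_of_nonneg_right h2 (Real.sqrt_nonneg d)
  linarith

theorem zsqrtdHeight_star (w : ℤ√d) : zsqrtdHeight (star w) = zsqrtdHeight w := by
  simp [zsqrtdHeight]

theorem not_eq_mul_self_of_squarefree (hd2 : 2 ≤ d) (hd : Squarefree d) (n : ℤ) :
    d ≠ n * n := by
  rintro rfl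
  have h := hd n dvd_rfl
  rcases Int.isUnit_iff.1 h with rfl | rfl <;> norm_num at hd2

theorem zsqrtdVal_injective (hd2 : 2 ≤ d) (hd : Squarefree d) :
    Function.Injective (zsqrtdVal d) := by
  have h := Zsqrtd.toReal_injective (by omega) (not_eq_mul_self_of_squarefree hd2 hd)
  rwa [← funext (zsqrtdVal_eq_toReal (d := d) (by omega))] at h

theorem zsqrtdVal_mul_star (hd : 0 ≤ d) (w : ℤ√d) :
    zsqrtdVal d w * zsqrtdVal d (star w) = (w.norm : ℝ) := by
  rw [zsqrtdVal_eq_toReal hd, zsqrtdVal_eq_toReal hd, ← map_mul, ← Zsqrtd.norm_eq_mul_conj]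
  simp

/-- Real quadratic irrationals are badly approximable: a nonzero element of `ℤ[√d]` has norm at
least `1` in absolute value, so it is at least of the order of the inverse of its height. -/
theorem one_le_abs_zsqrtdVal_mul (hd2 : 2 ≤ d) (hd : Squarefree d) {w : ℤ√d} (hw : w ≠ 0) :
    1 ≤ |zsqrtdVal d w| * (zsqrtdHeight w * (1 + Real.sqrt d)) := by
  have hn : w.norm ≠ 0 := fun h =>
    hw ((Zsqrtd.norm_eq_zero (not_eq_mul_self_of_squarefree hd2 hd) w).1 h)
  have h1 : (1 : ℝ) ≤ |(w.norm : ℝ)| := by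
    rw [← Int.cast_abs]
    exact_mod_cast Int.one_le_abs hn
  rw [← zsqrtdVal_mul_star (by omega), abs_mul] at h1
  refine h1.trans (mul_le_mul_of_nonneg_left ?_ (abs_nonneg _))
  rw [← zsqrtdHeight_star]
  exact abs_zsqrtdVal_le _

/-- Distinct points of `ℤ[√d]` of height at most `M` are separated by a multiple of `1 / M`. -/
theorem one_le_abs_zsqrtdVal_sub (hd2 : 2 ≤ d) (hd : Squarefree d) {w z : ℤ√d} {M : ℝ}
    (hw : zsqrtdHeight w ≤ M) (hz : zsqrtdHeight z ≤ M) (hne : w ≠ z) :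
    1 ≤ |zsqrtdVal d w - zsqrtdVal d z| * (2 * M * (1 + Real.sqrt d)) := by
  have h := one_le_abs_zsqrtdVal_mul hd2 hd (sub_ne_zero.2 hne)
  rw [zsqrtdVal_sub] at h
  refine h.trans (mul_le_mul_of_nonneg_left ?_ (abs_nonneg _))
  refine mul_le_mul_of_nonneg_right ?_ (by positivity)
  linarith [zsqrtdHeight_sub_le w z]

/-- A unit of norm `1` larger than `1`, from Pell's equation. -/
theorem exists_unit_zsqrtd (hd2 : 2 ≤ d) (hd : Squarefree d) :
    ∃ e : ℤ√d, 1 < zsqrtdVal d e ∧ zsqrtdVal d e * zsqrtdVal d (star e) = 1 := by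
  obtain ⟨x, y, h, hy⟩ := Pell.exists_of_not_isSquare (d := d) (by omega)
    (fun ⟨n, hn⟩ => not_eq_mul_self_of_squarefree hd2 hd n hn)
  refine ⟨⟨|x|, |y|⟩, ?_, ?_⟩
  · have hy1 : (1 : ℝ) ≤ |(y : ℝ)| := by
      rw [← Int.cast_abs]
      exact_mod_cast Int.one_le_abs hy
    have hs : 1 < Real.sqrt d := by
      rw [Real.lt_sqrt (by norm_num)]
      have : (2 : ℝ) ≤ d := by exact_mod_cast hd2
      linarith
    unfold zsqrtdVal
    push_cast
    nlinarith [abs_nonneg (x : ℝ)]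
  · rw [zsqrtdVal_mul_star (by omega), Zsqrtd.norm_def]
    norm_cast
    have e1 := abs_mul_abs_self x
    have e2 := abs_mul_abs_self y
    linear_combination h + e1 - d * e2

/-- Every real number is within `(1 + √d) / 2` of an element of `ℤ[√d]` whose conjugate is at most
`(1 + √d) / 2` in absolute value; it is found by rounding the two coordinates. -/
theorem exists_zsqrtd_near (hd2 : 2 ≤ d) (c : ℝ) :
    ∃ w : ℤ√d, |zsqrtdVal d w - c| ≤ (1 + Real.sqrt d) / 2 ∧
      |zsqrtdVal d (star w)| ≤ (1 + Real.sqrt d) / 2 := by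
  have hs : 0 < Real.sqrt d := Real.sqrt_pos.2 (by exact_mod_cast (by omega : 0 < d))
  have h1 := abs_sub_round (c / 2)
  have h2 := abs_sub_round (c / (2 * Real.sqrt d))
  set m := round (c / 2)
  set n := round (c / (2 * Real.sqrt d))
  have h3 : |c / 2 - n * Real.sqrt d| ≤ Real.sqrt d / 2 := by
    have : c / 2 - n * Real.sqrt d = (c / (2 * Real.sqrt d) - n) * Real.sqrt d := by
      field_simp
    rw [this, abs_mul, abs_of_pos hs]
    nlinarith
  rw [abs_le] at h1 h3
  refine ⟨⟨m, n⟩, ?_, ?_⟩ <;> simp only [zsqrtdVal, Zsqrtd.re_star, Zsqrtd.im_star] <;>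
    push_cast <;> rw [abs_le] <;> constructor <;> linarith

/-- An element whose two conjugates are bounded by `B` has height at most `B`. -/
theorem zsqrtdHeight_le_of_conjugates (hd2 : 2 ≤ d) {w : ℤ√d} {B : ℝ}
    (h1 : |zsqrtdVal d w| ≤ B) (h2 : |zsqrtdVal d (star w)| ≤ B) : zsqrtdHeight w ≤ B := by
  have hs : 1 ≤ Real.sqrt d := by
    rw [Real.one_le_sqrt]
    exact_mod_cast (by omega : 1 ≤ d)
  simp only [zsqrtdVal, Zsqrtd.re_star, Zsqrtd.im_star] at h1 h2
  push_cast at h2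
  rw [abs_le] at h1 h2
  have h3 : |(w.im : ℝ)| * Real.sqrt d ≤ B := by
    rw [← abs_of_nonneg (Real.sqrt_nonneg d), ← abs_mul, abs_le]
    constructor <;> linarith
  refine max_le (abs_le.2 ⟨by linarith, by linarith⟩) ?_
  nlinarith [abs_nonneg (w.im : ℝ)]

/-- In a bounded region, every interval of length `L` contains a point of `ℤ[√d]` of height at
most a multiple of `1 / L`. Multiplication by a power of a unit of norm `1` stretches the interval
to a length of order `1`, where such a point with bounded conjugate is found by rounding; the
multiplication by the inverse of that power enlarges the conjugate by a factor of order `1 / L`. -/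
theorem exists_zsqrtd_mem_Ioo (hd2 : 2 ≤ d) (hd : Squarefree d) (R : ℝ) :
    ∃ K : ℝ, 0 < K ∧ ∀ a b : ℝ, -R ≤ a → a < b → b ≤ R →
      ∃ w : ℤ√d, zsqrtdVal d w ∈ Ioo a b ∧ zsqrtdHeight w * (b - a) ≤ K := by
  obtain ⟨e, he1, he2⟩ := exists_unit_zsqrtd hd2 hd
  have hd0 : 0 ≤ d := by omega
  set η := zsqrtdVal d e
  set A := 1 + Real.sqrt d with hA
  have hA0 : 0 < A := by positivity
  have hη : 0 < η := by linarith
  have hpos : 0 < 2 * |R| * |R| + A * η * (2 * |R| + A) := by positivity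
  refine ⟨_, hpos, fun a b ha hab hb => ?_⟩
  have hL : 0 < b - a := by linarith
  have hR : 0 < R := by linarith
  rw [abs_of_pos hR]
  obtain ⟨n, hn1, hn2⟩ := exists_nat_pow_near (le_max_left 1 (A / (b - a))) he1
  have hk1 : A < η ^ (n + 1) * (b - a) := by
    rw [← div_lt_iff₀ hL]
    exact (le_max_right _ _).trans_lt hn2
  have hk2 : η ^ (n + 1) * (b - a) ≤ η * (2 * R + A) := by
    have h1 : max 1 (A / (b - a)) * (b - a) ≤ 2 * R + A := by
      rw [max_mul_of_nonneg _ _ hL.le, div_mul_cancel₀ _ hL.ne']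
      exact max_le (by linarith) (by linarith)
    rw [pow_succ']
    calc η * η ^ n * (b - a) ≤ η * max 1 (A / (b - a)) * (b - a) := by gcongr
      _ = η * (max 1 (A / (b - a)) * (b - a)) := by ring
      _ ≤ _ := by gcongr
  set k := n + 1
  have hηk : 0 < η ^ k := by positivity
  obtain ⟨w, hw1, hw2⟩ := exists_zsqrtd_near hd2 ((a + b) / 2 * η ^ k)
  have hstar : zsqrtdVal d (star e) ^ k * η ^ k = 1 := by
    rw [← mul_pow, mul_comm, he2, one_pow]
  have hval : zsqrtdVal d (w * star e ^ k) * η ^ k = zsqrtdVal d w := by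
    rw [zsqrtdVal_eq_toReal hd0, map_mul, map_pow, ← zsqrtdVal_eq_toReal, ← zsqrtdVal_eq_toReal,
      mul_assoc, hstar, mul_one]
  have hconj : zsqrtdVal d (star (w * star e ^ k)) = zsqrtdVal d (star w) * η ^ k := by
    rw [star_mul, star_pow, star_star, mul_comm, zsqrtdVal_eq_toReal hd0, map_mul, map_pow,
      ← zsqrtdVal_eq_toReal, ← zsqrtdVal_eq_toReal]
  have hmem : zsqrtdVal d (w * star e ^ k) ∈ Ioo a b := by
    rw [abs_le] at hw1
    constructor
    · refine lt_of_mul_lt_mul_right ?_ hηk.le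
      rw [hval]
      nlinarith
    · refine lt_of_mul_lt_mul_right ?_ hηk.le
      rw [hval]
      nlinarith
  refine ⟨_, hmem, ?_⟩
  have hB : zsqrtdHeight (w * star e ^ k) ≤ R + A * η ^ k := by
    refine zsqrtdHeight_le_of_conjugates hd2 ?_ ?_
    · have : |zsqrtdVal d (w * star e ^ k)| ≤ R :=
        abs_le.2 ⟨by linarith [hmem.1], by linarith [hmem.2]⟩
      nlinarith
    · rw [hconj, abs_mul, abs_of_pos hηk]
      nlinarith
  calc zsqrtdHeight (w * star e ^ k) * (b - a) ≤ (R + A * η ^ k) * (b - a) := by gcongr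
    _ = R * (b - a) + A * (η ^ k * (b - a)) := by ring
    _ ≤ R * (2 * R) + A * (η * (2 * R + A)) := by
      gcongr
      linarith
    _ = _ := by ring

end Arithmetic

/-! ### Sets cut out by points of bounded height -/

/-- The set of points of `ℤ[√d]`, as real numbers, of height at most `M`. -/
def boundedPoints (d : ℤ) (M : ℝ) : Set ℝ :=
  {x | ∃ w : ℤ√d, zsqrtdVal d w = x ∧ zsqrtdHeight w ≤ M}

section BoundedPoints

variable {d : ℤ} {M N x y : ℝ}

theorem boundedPoints_mono (h : M ≤ N) : boundedPoints d M ⊆ boundedPoints d N :=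
  fun _ ⟨w, hw, hM⟩ => ⟨w, hw, hM.trans h⟩

theorem add_mem_boundedPoints (hx : x ∈ boundedPoints d M) (hy : y ∈ boundedPoints d N) :
    x + y ∈ boundedPoints d (M + N) := by
  obtain ⟨w, rfl, hw⟩ := hx
  obtain ⟨z, rfl, hz⟩ := hy
  exact ⟨w + z, zsqrtdVal_add w z, (zsqrtdHeight_add_le w z).trans (add_le_add hw hz)⟩

theorem sub_mem_boundedPoints (hx : x ∈ boundedPoints d M) (hy : y ∈ boundedPoints d N) :
    x - y ∈ boundedPoints d (M + N) := by
  obtain ⟨w, rfl, hw⟩ := hx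
  obtain ⟨z, rfl, hz⟩ := hy
  exact ⟨w - z, zsqrtdVal_sub w z, (zsqrtdHeight_sub_le w z).trans (add_le_add hw hz)⟩

end BoundedPoints

namespace IET

variable {s : ℕ} (T : IET s)

/-- The endpoints of the domain, the separation points and the translation values of `T` are in
`ℤ[√d]`, with heights at most `κ`, where `κ ≥ 1`. -/
structure HeightBound (d : ℤ) (κ : ℝ) : Prop where
  one_le : 1 ≤ κ
  l_mem : T.l ∈ boundedPoints d κ
  r_mem : T.r ∈ boundedPoints d κ
  gamma_mem : ∀ i, T.gamma i ∈ boundedPoints d κ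
  alpha_mem : ∀ i, T.alpha i ∈ boundedPoints d κ

theorem exists_heightBound {d : ℤ} (hT : T.IsNormalizedOver d) : ∃ κ, T.HeightBound d κ := by
  obtain ⟨⟨wl, hl⟩, hlen⟩ := hT
  choose wlen hlen using hlen
  have hsum : ∀ S : Finset (Fin s),
      zsqrtdVal d (wl + ∑ j ∈ S, wlen j) = T.l + ∑ j ∈ S, T.len j := fun S => by
    rw [zsqrtdVal_add, zsqrtdVal_sum, hl]
    simp only [hlen]
  let g : Fin s → ℤ√d := fun i => wl + ∑ j ∈ Finset.univ.filter (fun j => j < i), wlen j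
  let e : Fin s → ℤ√d := fun i =>
    wl + ∑ j ∈ Finset.univ.filter (fun j => T.perm j < T.perm i), wlen j
  let w : ℤ√d := wl + ∑ j, wlen j
  have hnn : ∀ f : Fin s → ℤ√d, 0 ≤ ∑ i, zsqrtdHeight (f i) := fun f =>
    Finset.sum_nonneg fun i _ => zsqrtdHeight_nonneg _
  have hle : ∀ (f : Fin s → ℤ√d) (i), zsqrtdHeight (f i) ≤ ∑ i, zsqrtdHeight (f i) :=
    fun f i => Finset.single_le_sum (f := fun i => zsqrtdHeight (f i))
      (fun i _ => zsqrtdHeight_nonneg _) (Finset.mem_univ i)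
  have h1 := hnn g
  have h2 := hnn (fun i => e i - g i)
  have h3 := zsqrtdHeight_nonneg wl
  have h4 := zsqrtdHeight_nonneg w
  refine ⟨1 + zsqrtdHeight wl + zsqrtdHeight w + ∑ i, zsqrtdHeight (g i)
    + ∑ i, zsqrtdHeight (e i - g i), by linarith, ⟨wl, hl, by linarith⟩,
    ⟨w, hsum _, by linarith⟩, fun i => ⟨g i, hsum _, by linarith [hle g i]⟩, fun i =>
    ⟨e i - g i, ?_, by linarith [hle (fun i => e i - g i) i]⟩⟩
  rw [zsqrtdVal_sub, hsum, hsum]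
  rfl

/-- A subset of the domain is adapted to the height `M` if its indicator function is constant
between consecutive points of height at most `M`: the only places where it can change are at such
points, with the value at the point being the one to its right. -/
def Adapted (d : ℤ) (M : ℝ) (A : Set T.Domain) : Prop :=
  ∀ x y : T.Domain, x < y → (∀ p ∈ boundedPoints d M, p ∉ Ioc (x : ℝ) y) → (x ∈ A ↔ y ∈ A)

variable {T} {d : ℤ} {M N κ : ℝ} {A B : Set T.Domain}

theorem Adapted.mono (h : T.Adapted d M A) (hMN : M ≤ N) : T.Adapted d N A :=
  fun x y hxy hp => h x y hxy fun p hpM => hp p (boundedPoints_mono hMN hpM)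

theorem Adapted.compl (h : T.Adapted d M A) : T.Adapted d M Aᶜ :=
  fun x y hxy hp => not_congr (h x y hxy hp)

theorem Adapted.inter (hA : T.Adapted d M A) (hB : T.Adapted d M B) :
    T.Adapted d M (A ∩ B) :=
  fun x y hxy hp => and_congr (hA x y hxy hp) (hB x y hxy hp)

theorem Adapted.diff (hA : T.Adapted d M A) (hB : T.Adapted d M B) :
    T.Adapted d M (A \ B) :=
  hA.inter hB.compl

theorem adapted_Ico {a b : ℝ} (ha : a ∈ boundedPoints d M) (hb : b ∈ boundedPoints d M) :
    T.Adapted d M (Subtype.val ⁻¹' Ico a b) := by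
  intro x y hxy hp
  have hxy' : (x : ℝ) < y := hxy
  have h1 : a ≤ x ↔ a ≤ y :=
    ⟨fun h => h.trans hxy'.le, fun h => not_lt.1 fun h' => hp a ha ⟨h', h⟩⟩
  have h2 : (x : ℝ) < b ↔ (y : ℝ) < b :=
    ⟨fun h => not_le.1 fun h' => hp b hb ⟨h, h'⟩, fun h => hxy'.trans h⟩
  exact and_congr h1 h2

theorem map_coe (z : T.Domain) : (T.map z : ℝ) = z + T.alpha (T.idx z) := rfl

theorem idx_eq_of_mem {z : T.Domain} {i : Fin s} (h : (z : ℝ) ∈ T.piece i) : T.idx z = i :=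
  (T.existsUnique_mem 1 z.2).unique (T.mem_piece_idx z) h

theorem Adapted.preimage_map (hκ : T.HeightBound d κ) (hM : 0 ≤ M) (h : T.Adapted d M A) :
    T.Adapted d (M + κ) (T.map ⁻¹' A) := by
  intro x y hxy hp
  have hxy' : (x : ℝ) < y := hxy
  have hy := T.mem_piece_idx y
  have hidx : T.idx x = T.idx y := by
    refine idx_eq_of_mem ⟨?_, hxy'.trans hy.2⟩
    refine not_lt.1 fun hlt => hp _ (boundedPoints_mono ?_ (hκ.gamma_mem (T.idx y))) ⟨hlt, hy.1⟩
    linarith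
  refine h (T.map x) (T.map y) ?_ fun p hpM hpxy => ?_
  · rw [← Subtype.coe_lt_coe, map_coe, map_coe, hidx]
    linarith
  · rw [map_coe, map_coe, hidx] at hpxy
    refine hp _ (sub_mem_boundedPoints hpM (hκ.alpha_mem (T.idx y))) ⟨?_, ?_⟩
    · linarith [hpxy.1]
    · linarith [hpxy.2]

/-! ### The invariant measure -/

/-- The Lebesgue measure on the domain of `T`. -/
def lebesgue (T : IET s) : MeasureTheory.Measure T.Domain :=
  MeasureTheory.volume.comap Subtype.val

theorem lebesgue_apply (A : Set T.Domain) :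
    T.lebesgue A = MeasureTheory.volume (Subtype.val '' A : Set ℝ) :=
  comap_subtype_coe_apply measurableSet_Ico _ A

theorem lebesgue_univ : T.lebesgue univ = ENNReal.ofReal (T.r - T.l) := by
  rw [lebesgue_apply, image_univ, Subtype.range_coe, Real.volume_Ico]

instance : MeasureTheory.IsFiniteMeasure T.lebesgue :=
  ⟨by rw [lebesgue_univ]; exact ENNReal.ofReal_lt_top⟩

theorem l_lt_r (T : IET s) : T.l < T.r :=
  lt_add_of_pos_right _ (Finset.sum_pos (fun j _ => T.len_pos j) ⟨⟨0, T.size_pos⟩, by simp⟩)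

theorem lebesgue_real_le (A : Set T.Domain) : T.lebesgue.real A ≤ T.r - T.l := by
  refine (MeasureTheory.measureReal_mono (subset_univ A)).trans ?_
  rw [MeasureTheory.measureReal_def, lebesgue_univ,
    ENNReal.toReal_ofReal (sub_nonneg.2 T.l_lt_r.le)]

theorem le_lebesgue_real_of_Ioo_subset {a b : ℝ}
    (h : Ioo a b ⊆ Subtype.val '' A) : b - a ≤ T.lebesgue.real A := by
  rcases le_or_gt b a with hab | hab
  · exact (sub_nonpos.2 hab).trans MeasureTheory.measureReal_nonneg
  have h1 := MeasureTheory.measure_mono (μ := MeasureTheory.volume) h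
  rw [← lebesgue_apply, Real.volume_Ioo] at h1
  have h2 := ENNReal.toReal_mono (MeasureTheory.measure_ne_top _ A) h1
  rwa [ENNReal.toReal_ofReal (by linarith)] at h2

/-- A nonempty set adapted to the height `M` contains an interval of length of order `1 / M`, as
the points of height at most `M` are that far apart. -/
theorem Adapted.le_lebesgue_real (hd2 : 2 ≤ d) (hd : Squarefree d) (hM : 0 < M)
    (hl : T.l ∈ boundedPoints d M) (hr : T.r ∈ boundedPoints d M)
    (h : T.Adapted d M A) (hne : A.Nonempty) :
    1 / (4 * M * (1 + Real.sqrt d)) ≤ T.lebesgue.real A := by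
  obtain ⟨x, hx⟩ := hne
  have hden : 0 < 4 * M * (1 + Real.sqrt d) := by positivity
  set δ := 1 / (4 * M * (1 + Real.sqrt d)) with hδ
  have hδ0 : 0 < δ := by positivity
  have hδ1 : δ * (4 * M * (1 + Real.sqrt d)) = 1 := by
    rw [hδ, one_div, inv_mul_cancel₀ hden.ne']
  have hsep : ∀ p ∈ boundedPoints d M, ∀ q ∈ boundedPoints d M, p < q → 2 * δ ≤ q - p := by
    rintro _ ⟨w, rfl, hw⟩ _ ⟨z, rfl, hz⟩ hlt
    have h1 := one_le_abs_zsqrtdVal_sub hd2 hd hz hw (by rintro rfl; exact lt_irrefl _ hlt)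
    rw [abs_of_pos (by linarith)] at h1
    by_contra hcon
    push Not at hcon
    have h2 : 0 < 2 * M * (1 + Real.sqrt d) := by positivity
    nlinarith [mul_lt_mul_of_pos_right hcon h2]
  by_cases hfree : ∀ p ∈ boundedPoints d M, p ∉ Ioc (x : ℝ) (x + δ)
  · have hxr : (x : ℝ) + δ < T.r := not_le.1 fun hle => hfree _ hr ⟨x.2.2, hle⟩
    have := le_lebesgue_real_of_Ioo_subset (A := A) (a := x) (b := x + δ) fun y hy => by
      refine ⟨⟨y, x.2.1.trans hy.1.le, hy.2.trans hxr⟩, ?_, rfl⟩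
      refine (h x _ hy.1 fun p hp hpm => hfree p hp ⟨hpm.1, hpm.2.trans hy.2.le⟩).1 hx
    linarith
  · push Not at hfree
    obtain ⟨q, hq, hqx⟩ := hfree
    have hfree' : ∀ p ∈ boundedPoints d M, p ∉ Ioc ((x : ℝ) - δ) x := fun p hp hpx => by
      have := hsep p hp q hq (hpx.2.trans_lt hqx.1)
      linarith [hpx.1, hqx.2]
    have hxl : T.l ≤ (x : ℝ) - δ := not_lt.1 fun hlt => hfree' _ hl ⟨hlt, x.2.1⟩
    have := le_lebesgue_real_of_Ioo_subset (A := A) (a := x - δ) (b := x) fun y hy => by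
      refine ⟨⟨y, hxl.trans hy.1.le, hy.2.trans x.2.2⟩, ?_, rfl⟩
      refine (h _ x hy.2 fun p hp hpm => hfree' p hp ⟨hy.1.trans hpm.1, hpm.2⟩).2 hx
    linarith

theorem measurableSet_idx_eq (i : Fin s) : MeasurableSet {z : T.Domain | T.idx z = i} := by
  have : {z : T.Domain | T.idx z = i} = Subtype.val ⁻¹' T.piece i := by
    ext z
    exact ⟨fun h => by rw [← show T.idx z = i from h]; exact T.mem_piece_idx z, idx_eq_of_mem⟩
  rw [this]
  exact measurable_subtype_coe measurableSet_Ico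

theorem measurable_map : Measurable (T.map : T.Domain → T.Domain) := by
  have hidx : Measurable T.idx := measurable_to_countable' fun i => measurableSet_idx_eq i
  refine Measurable.subtype_mk ?_
  exact measurable_subtype_coe.add ((measurable_of_finite T.alpha).comp hidx)

/-- An interval exchange transformation preserves the Lebesgue measure. -/
theorem measurePreserving_map : 
    MeasureTheory.MeasurePreserving (T.map : T.Domain → T.Domain) T.lebesgue T.lebesgue := by
  refine ⟨measurable_map, MeasureTheory.Measure.ext fun A hA => ?_⟩
  rw [MeasureTheory.Measure.map_apply measurable_map hA]
  let P : Fin s → Set T.Domain := fun i => {z | T.idx z = i}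
  have hPm : ∀ i, MeasurableSet (P i) := measurableSet_idx_eq
  have hdisj : Pairwise (Function.onFun Disjoint P) := fun i j hij =>
    Set.disjoint_left.2 fun z (hi : T.idx z = i) (hj : T.idx z = j) => hij (hi.symm.trans hj)
  have hpre : MeasurableSet (T.map ⁻¹' A) := measurable_map hA
  have himg : ∀ i, (Subtype.val '' (T.map '' (T.map ⁻¹' A ∩ P i)) : Set ℝ)
      = (fun x => x + T.alpha i) '' (Subtype.val '' (T.map ⁻¹' A ∩ P i)) := fun i => by
    rw [image_image, image_image]
    refine image_congr fun z hz => ?_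
    rw [map_coe, show T.idx z = i from hz.2]
  have hvol : ∀ i, T.lebesgue (T.map '' (T.map ⁻¹' A ∩ P i))
      = T.lebesgue (T.map ⁻¹' A ∩ P i) := fun i => by
    rw [lebesgue_apply, himg, lebesgue_apply, image_add_right]
    exact MeasureTheory.measure_preimage_add_right _ _ _
  have hmeas : ∀ i, MeasurableSet (T.map '' (T.map ⁻¹' A ∩ P i)) := fun i => by
    rw [← preimage_image_eq (T.map '' _) Subtype.val_injective, himg]
    refine measurable_subtype_coe ?_
    exact (MeasurableEquiv.addRight (T.alpha i)).measurableSet_image.2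
      (measurableSet_Ico.subtype_image (hpre.inter (hPm i)))
  have hA' : A = ⋃ i, T.map '' (T.map ⁻¹' A ∩ P i) := by
    rw [← image_iUnion, ← inter_iUnion, show ⋃ i, P i = univ from
      eq_univ_of_forall fun z => mem_iUnion.2 ⟨T.idx z, rfl⟩, inter_univ,
      image_preimage_eq _ T.map.surjective]
  have hB : T.map ⁻¹' A = ⋃ i, T.map ⁻¹' A ∩ P i := by
    rw [← inter_iUnion, show ⋃ i, P i = univ from
      eq_univ_of_forall fun z => mem_iUnion.2 ⟨T.idx z, rfl⟩, inter_univ]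
  conv_rhs => rw [hA']
  conv_lhs => rw [hB]
  rw [MeasureTheory.measure_iUnion (hdisj.mono fun i j h => h.mono inter_subset_right
    inter_subset_right) fun i => hpre.inter (hPm i),
    MeasureTheory.measure_iUnion _ hmeas]
  · exact tsum_congr fun i => (hvol i).symm
  · exact fun i j hij => (Set.disjoint_image_iff T.map.injective).2
      ((hdisj hij).mono inter_subset_right inter_subset_right)

end IET

namespace IET

variable {s : ℕ} {T : IET s} {d : ℤ} {M κ : ℝ} {J : Set T.Domain}

/-! ### Points avoiding a set for a long time -/

/-- The points whose iterates `z, T z, …, T^t z` are all outside `J`. -/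
def avoiding (J : Set T.Domain) (t : ℕ) : Set T.Domain := {z | ∀ i ≤ t, (T.map ^ i) z ∉ J}

theorem avoiding_zero : avoiding J 0 = Jᶜ := by
  ext z
  simp [avoiding]

theorem avoiding_succ (t : ℕ) : avoiding J (t + 1) = Jᶜ ∩ T.map ⁻¹' avoiding J t := by
  ext z
  constructor
  · exact fun h => ⟨h 0 (Nat.zero_le _), fun i hi => by
      have := h (i + 1) (by omega)
      rwa [pow_succ, Equiv.Perm.mul_apply] at this⟩
  · rintro ⟨h0, h⟩ (_ | i) hi
    · exact h0
    · rw [pow_succ, Equiv.Perm.mul_apply]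
      exact h i (by omega)

theorem avoiding_anti {t u : ℕ} (h : t ≤ u) : avoiding J u ⊆ avoiding J t :=
  fun _ hz i hi => hz i (hi.trans h)

theorem measurableSet_avoiding (hJ : MeasurableSet J) (t : ℕ) :
    MeasurableSet (avoiding J t) := by
  induction t with
  | zero => rw [avoiding_zero]; exact hJ.compl
  | succ t ih => rw [avoiding_succ]; exact hJ.compl.inter (measurable_map ih)

theorem adapted_avoiding (hκ : T.HeightBound d κ) (hM : 0 ≤ M) (hJ : T.Adapted d M J) (t : ℕ) :
    T.Adapted d (M + t * κ) (avoiding J t) := by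
  have hκ0 : 0 ≤ κ := zero_le_one.trans hκ.one_le
  induction t with
  | zero => rw [avoiding_zero]; exact hJ.compl.mono (by simp)
  | succ t ih =>
    rw [avoiding_succ]
    have h : M + ((t + 1 : ℕ) : ℝ) * κ = M + t * κ + κ := by push_cast; ring
    rw [h]
    exact (hJ.compl.mono (by nlinarith [mul_nonneg (Nat.cast_nonneg (α := ℝ) t) hκ0])).inter (ih.preimage_map hκ (by positivity))

/-- If `J` contains a nonempty open set and some point avoids `J` for the time `t`, then some such
point enters `J` at the time `t + 1`. Otherwise the set of the points avoiding `J` for the time `t`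
is mapped into itself by `T`; as `T` preserves the measure and nonempty adapted sets have positive
measure, it is also invariant under the inverse of `T`, and so it contains an entire orbit, which
is dense. -/
theorem avoiding_diff_nonempty (hd2 : 2 ≤ d) (hd : Squarefree d) (hmin : T.IsMinimal)
    (hκ : T.HeightBound d κ) (hM : 0 ≤ M) (hJ : T.Adapted d M J) (hJm : MeasurableSet J)
    {U : Set T.Domain} (hU : IsOpen U) (hUne : U.Nonempty) (hUJ : U ⊆ J)
    {t : ℕ} (hne : (avoiding J t).Nonempty) : (avoiding J t \ avoiding J (t + 1)).Nonempty := by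
  by_contra hcon
  have hκ1 := hκ.one_le
  rw [not_nonempty_iff_eq_empty, sdiff_eq_empty, avoiding_succ] at hcon
  have hsub : avoiding J t ⊆ T.map ⁻¹' avoiding J t := fun z hz => (hcon hz).2
  have hm := measurableSet_avoiding hJm t
  have hvol : T.lebesgue (T.map ⁻¹' avoiding J t \ avoiding J t) = 0 := by
    rw [MeasureTheory.measure_sdiff hsub hm.nullMeasurableSet (MeasureTheory.measure_ne_top _ _),
      measurePreserving_map.measure_preimage hm.nullMeasurableSet, tsub_self]
  have hA := adapted_avoiding hκ hM hJ t
  have hA0 : (0 : ℝ) ≤ M + t * κ := by positivity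
  have heq : T.map ⁻¹' avoiding J t ⊆ avoiding J t := by
    rw [← sdiff_eq_empty, ← not_nonempty_iff_eq_empty]
    intro hne'
    have hle := ((hA.preimage_map hκ hA0).diff (hA.mono (by linarith))).le_lebesgue_real hd2 hd
      (by linarith) (boundedPoints_mono (by linarith) hκ.l_mem)
      (boundedPoints_mono (by linarith) hκ.r_mem) hne'
    rw [MeasureTheory.measureReal_def, hvol, ENNReal.toReal_zero] at hle
    have : 0 < 1 / (4 * (M + t * κ + κ) * (1 + Real.sqrt d)) := by positivity
    linarith
  obtain ⟨x, hx⟩ := hne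
  have horbit : ∀ n : ℤ, (T.map ^ n) x ∈ avoiding J t := fun n => by
    induction n with
    | zero => exact hx
    | succ n ih =>
      rw [add_comm, zpow_one_add, Equiv.Perm.mul_apply]
      exact hsub ih
    | pred n ih =>
      refine heq ?_
      rw [mem_preimage, ← Equiv.Perm.mul_apply, ← zpow_one_add]
      rwa [add_sub_cancel]
  obtain ⟨_, hyU, n, rfl⟩ := (hmin x).exists_mem_open hU hUne |>.imp fun y hy => hy.symm
  exact horbit n 0 (Nat.zero_le _) (hUJ hyU)

/-- Logarithmic bound for avoidance. The sets of the points avoiding `J` for exactly the time `t`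
are disjoint, and of measure at least of the order of `1 / (M + t)` as long as they are nonempty;
the partial sums of these lower bounds grow like a logarithm and are at most `r - l`. -/
theorem log_le_of_avoiding_nonempty (hd2 : 2 ≤ d) (hd : Squarefree d) (hmin : T.IsMinimal)
    (hκ : T.HeightBound d κ) (hM : 0 ≤ M) (hJ : T.Adapted d M J) (hJm : MeasurableSet J)
    {U : Set T.Domain} (hU : IsOpen U) (hUne : U.Nonempty) (hUJ : U ⊆ J)
    {k : ℕ} (hne : (avoiding J k).Nonempty) :
    Real.log (M + 1 + k) - Real.log (M + 1) ≤
      4 * κ * (1 + Real.sqrt d) * (T.r - T.l) := by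
  have hκ1 := hκ.one_le
  set b := 4 * κ * (1 + Real.sqrt d) with hb
  have hb0 : 0 < b := by positivity
  have key : ∀ t ≤ k, Real.log (M + 1 + t) - Real.log (M + 1) ≤
      b * (T.r - T.l - T.lebesgue.real (avoiding J t)) := by
    intro t
    induction t with
    | zero =>
      intro _
      have := lebesgue_real_le (avoiding J 0)
      have := mul_nonneg hb0.le (sub_nonneg.2 this)
      simpa using this
    | succ t ih =>
      intro ht
      have h1 := ih (by omega)
      have h2 := avoiding_diff_nonempty hd2 hd hmin hκ hM hJ hJm hU hUne hUJ
        (hne.mono (avoiding_anti (show t ≤ k by omega)))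
      have hA := (adapted_avoiding hκ hM hJ t).mono
        (show M + t * κ ≤ (M + 1 + t) * κ by nlinarith)
      have hB := (adapted_avoiding hκ hM hJ (t + 1)).mono
        (show M + (t + 1 : ℕ) * κ ≤ (M + 1 + t) * κ by push_cast; nlinarith)
      have hx : 0 < M + 1 + t := by positivity
      have hκle : κ ≤ (M + 1 + t) * κ := by nlinarith [(Nat.cast_nonneg t : (0 : ℝ) ≤ t)]
      have h3 := (hA.diff hB).le_lebesgue_real hd2 hd (by positivity)
        (boundedPoints_mono hκle hκ.l_mem) (boundedPoints_mono hκle hκ.r_mem) h2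
      rw [MeasureTheory.measureReal_sdiff (avoiding_anti (Nat.le_succ t))
        (measurableSet_avoiding hJm _)] at h3
      have h4 : 1 / (4 * ((M + 1 + t) * κ) * (1 + Real.sqrt d)) = (M + 1 + t)⁻¹ / b := by
        rw [hb]
        field_simp
      rw [h4, div_le_iff₀ hb0] at h3
      have h5 : Real.log (M + 1 + (t + 1 : ℕ)) - Real.log (M + 1 + t) ≤ (M + 1 + t)⁻¹ := by
        rw [← Real.log_div (by positivity) hx.ne']
        refine (Real.log_le_sub_one_of_pos (by positivity)).trans (le_of_eq ?_)
        push_cast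
        field_simp
        ring
      linarith
  refine (key k le_rfl).trans (mul_le_mul_of_nonneg_left ?_ hb0.le)
  linarith [MeasureTheory.measureReal_nonneg (μ := T.lebesgue) (s := avoiding J k)]

/-- Linear bound for return times: an orbit cannot avoid an interval of length `L` for a time longer
than a multiple of `1 / L`. -/
theorem exists_avoidance_bound (hd2 : 2 ≤ d) (hd : Squarefree d) (hT : T.IsNormalizedOver d)
    (hmin : T.IsMinimal) :
    ∃ C : ℝ, 0 < C ∧ ∀ u v : ℝ, T.l ≤ u → u < v → v ≤ T.r → ∀ (t : ℕ) (z : T.Domain),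
      (∀ i ≤ t, ((T.map ^ i) z : ℝ) ∉ Ioo u v) → t * (v - u) ≤ C := by
  obtain ⟨κ, hκ⟩ := T.exists_heightBound hT
  obtain ⟨K, hK0, hK⟩ := exists_zsqrtd_mem_Ioo hd2 hd (max (-T.l) T.r)
  set E := Real.exp (4 * κ * (1 + Real.sqrt d) * (T.r - T.l)) with hE
  have hlr := T.l_lt_r
  refine ⟨(2 * K + (T.r - T.l)) * E, by have := sub_pos.2 hlr; positivity, ?_⟩
  intro u v hu huv hv t z hz
  have hL : 0 < v - u := by linarith
  have hR1 := le_max_left (-T.l) T.r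
  have hR2 := le_max_right (-T.l) T.r
  obtain ⟨w₁, hw₁, hh₁⟩ := hK u ((u + v) / 2) (by linarith) (by linarith) (by linarith)
  obtain ⟨w₂, hw₂, hh₂⟩ := hK ((u + v) / 2) v (by linarith) (by linarith) (by linarith)
  -- The interval with these endpoints has height of order `1 / (v - u)`; its length is irrelevant.
  set M := 2 * K / (v - u) with hM
  have hM0 : 0 ≤ M := by positivity
  have hML : M * (v - u) = 2 * K := div_mul_cancel₀ _ hL.ne'
  have hb₁ : zsqrtdVal d w₁ ∈ boundedPoints d M :=
    ⟨w₁, rfl, by rw [hM, le_div_iff₀ hL]; linarith⟩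
  have hb₂ : zsqrtdVal d w₂ ∈ boundedPoints d M :=
    ⟨w₂, rfl, by rw [hM, le_div_iff₀ hL]; linarith⟩
  set a := zsqrtdVal d w₁
  set b := zsqrtdVal d w₂
  have hab : a < b := hw₁.2.trans hw₂.1
  have hne : (avoiding (T := T) (Subtype.val ⁻¹' Ico a b) t).Nonempty :=
    ⟨z, fun i hi h => hz i hi ⟨hw₁.1.trans_le h.1, h.2.trans hw₂.2⟩⟩
  have hlog := log_le_of_avoiding_nonempty hd2 hd hmin hκ hM0 (adapted_Ico hb₁ hb₂)
    (measurable_subtype_coe measurableSet_Ico) (U := Subtype.val ⁻¹' Ioo a b)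
    (isOpen_Ioo.preimage continuous_subtype_val)
    ⟨⟨(a + b) / 2, by linarith [hw₁.1], by linarith [hw₂.2]⟩, by
      constructor <;> simp only <;> linarith⟩
    (preimage_mono Ioo_subset_Ico_self) hne
  have hexp : M + 1 + t ≤ (M + 1) * E := by
    rw [← Real.exp_log (show 0 < M + 1 + t by positivity),
      ← Real.exp_log (show 0 < M + 1 by positivity), hE, ← Real.exp_add,
      Real.exp_log (show 0 < M + 1 by positivity), Real.exp_le_exp]
    linarith
  have hE0 : 0 < E := Real.exp_pos _
  calc t * (v - u) ≤ ((M + 1) * E) * (v - u) := by gcongr; linarith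
    _ = (M * (v - u) + (v - u)) * E := by ring
    _ ≤ _ := by rw [hML]; gcongr

/-! ### Endpoints of admissible semi-intervals -/

theorem symm_map_coe (z : T.Domain) :
    (T.map.symm z : ℝ) = z - T.alpha (T.idx (T.map.symm z)) := by
  have h := map_coe (T.map.symm z)
  rw [Equiv.apply_symm_apply] at h
  linarith

theorem zpow_map_mem_boundedPoints (hκ : T.HeightBound d κ) {z : T.Domain}
    (hz : (z : ℝ) ∈ boundedPoints d κ) (k : ℤ) :
    ((T.map ^ k) z : ℝ) ∈ boundedPoints d (κ + |(k : ℝ)| * κ) := by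
  have hpow : ∀ n : ℕ, ((T.map ^ n) z : ℝ) ∈ boundedPoints d (κ + n * κ) := fun n => by
    induction n with
    | zero => simpa using hz
    | succ n ih =>
      rw [pow_succ', Equiv.Perm.mul_apply, map_coe]
      convert add_mem_boundedPoints ih (hκ.alpha_mem _) using 2
      push_cast; ring
  have hinv : ∀ n : ℕ, ((T.map⁻¹ ^ n) z : ℝ) ∈ boundedPoints d (κ + n * κ) := fun n => by
    induction n with
    | zero => simpa using hz
    | succ n ih =>
      rw [pow_succ', Equiv.Perm.mul_apply, Equiv.Perm.inv_def, symm_map_coe, ← Equiv.Perm.inv_def]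
      convert sub_mem_boundedPoints ih (hκ.alpha_mem _) using 2
      push_cast; ring
  obtain ⟨n, rfl | rfl⟩ := k.eq_nat_or_neg
  · simpa using hpow n
  · simpa using hinv n

/-- The division points of `[u, v[` are in `ℤ[√d]`, with height at most a multiple of
`1 / (v - u)`: they are reached from the `γ_i` by orbit segments avoiding `]u, v[`. -/
theorem exists_divisionPoints_bound (hd2 : 2 ≤ d) (hd : Squarefree d)
    (hT : T.IsNormalizedOver d) (hmin : T.IsMinimal) :
    ∃ C : ℝ, 0 < C ∧ ∀ u v : ℝ, T.l ≤ u → u < v → v ≤ T.r →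
      T.divisionPoints u v ∪ {T.r} ⊆ boundedPoints d (C / (v - u)) := by
  obtain ⟨κ, hκ⟩ := T.exists_heightBound hT
  obtain ⟨C, hC0, hC⟩ := exists_avoidance_bound hd2 hd hT hmin
  have hlr := T.l_lt_r
  have hκ0 : 0 < κ := by linarith [hκ.one_le]
  refine ⟨κ * (C + 2 * (T.r - T.l)), by have := sub_pos.2 hlr; positivity, ?_⟩
  intro u v hu huv hv x hx
  have hL : 0 < v - u := by linarith
  rcases hx with hx | rfl
  · obtain ⟨i, k, hk1, hk2, rfl⟩ := mem_iUnion.1 hx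
    refine boundedPoints_mono ?_ (zpow_map_mem_boundedPoints hκ (hκ.gamma_mem i) k)
    have hk : |(k : ℝ)| * (v - u) ≤ C + (v - u) := by
      rcases lt_trichotomy k 0 with hneg | rfl | hpos
      -- For `k < 0` the points `T^(k+1)(γ_i), …, γ_i` avoid `]u, v[`.
      · obtain ⟨t, rfl⟩ : ∃ t : ℕ, k = -(t + 1 : ℕ) := ⟨(-k - 1).toNat, by omega⟩
        have := hC u v hu huv hv t ((T.map ^ (-(t : ℤ))) (T.sep i)) fun j hj => by
          have hlt : t - j < T.rhoMinus u v (T.sep i) := by omega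
          have h := Nat.notMem_of_lt_sInf hlt
          rw [mem_ofPred_eq] at h
          rwa [← zpow_natCast, ← Equiv.Perm.mul_apply, ← zpow_add,
            show (j : ℤ) + -t = -((t - j : ℕ) : ℤ) by omega]
        push_cast
        rw [abs_neg, abs_of_nonneg (by positivity)]
        linarith
      · simp only [Int.cast_zero, abs_zero, zero_mul]
        linarith
      -- For `k > 0` the points `T(γ_i), …, T^k(γ_i)` avoid `]u, v[`.
      · obtain ⟨t, rfl⟩ : ∃ t : ℕ, k = (t + 1 : ℕ) := ⟨(k - 1).toNat, by omega⟩
        have := hC u v hu huv hv t (T.map (T.sep i)) fun j hj => by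
          have hlt : j + 1 < T.rhoPlus u v (T.sep i) := by omega
          have h := Nat.notMem_of_lt_sInf hlt
          rw [mem_ofPred_eq, not_and] at h
          have := h (Nat.succ_pos j)
          rwa [zpow_natCast, pow_succ, Equiv.Perm.mul_apply] at this
        push_cast
        rw [abs_of_nonneg (by positivity)]
        linarith
    rw [le_div_iff₀ hL]
    calc (κ + |(k : ℝ)| * κ) * (v - u) = κ * ((v - u) + |(k : ℝ)| * (v - u)) := by ring
      _ ≤ _ := mul_le_mul_of_nonneg_left (by linarith) hκ0.le
  · refine boundedPoints_mono ?_ hκ.r_mem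
    rw [le_div_iff₀ hL]
    gcongr
    linarith

end IET

/-! ### The reduced complexity of a semi-interval -/

theorem psi_zsqrtdVal {d : ℤ} (hd2 : 2 ≤ d) (hd : Squarefree d) (w : ℤ√d) :
    (psi d (zsqrtdVal d w) : ℝ) = zsqrtdHeight w := by
  unfold psi
  rw [(zsqrtdVal_injective hd2 hd).extend_apply]
  simp [zsqrtdHeight, Nat.cast_natAbs]

theorem reducedComplexity_Ico (d : ℤ) {a b : ℝ} (h : a < b) :
    reducedComplexity d (Ico a b) = (b - a) * max (psi d a : ℝ) (psi d b) := by
  unfold reducedComplexity complexity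
  rw [frontier_Ico h, image_pair, csSup_pair, Nat.cast_max, Real.volume_real_Ico_of_le h.le]

end

theorem theorem6 (d : ℤ) (hd2 : 2 ≤ d) (hd : Squarefree d) (s : ℕ) (T : IET s)
    (hT : T.IsNormalizedOver d) (hmin : T.IsMinimal) :
    ∃ c C : ℝ, 0 < c ∧ 0 < C ∧ ∀ J : Set ℝ, T.IsAdmissible J →
      J ∈ T.algebraOver d ∧ c ≤ reducedComplexity d J ∧ reducedComplexity d J ≤ C := by
  obtain ⟨C, hC0, hC⟩ := T.exists_divisionPoints_bound hd2 hd hT hmin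
  have hs : 0 < 2 * (1 + Real.sqrt d) := by positivity
  refine ⟨1 / (2 * (1 + Real.sqrt d)), C, by positivity, hC0, ?_⟩
  rintro _ ⟨u, v, hu, huv, hv, rfl, hu', hv'⟩
  have hL : 0 < v - u := by linarith
  obtain ⟨w, rfl, hw⟩ := hC u v hu huv hv hu'
  obtain ⟨z, rfl, hz⟩ := hC _ v hu huv hv hv'
  refine ⟨⟨Ico_subset_Ico hu hv, 1, fun _ => zsqrtdVal d w, fun _ => zsqrtdVal d z,
    fun _ => ⟨⟨w, rfl⟩, ⟨z, rfl⟩, huv⟩, (iUnion_const _).symm⟩, ?_⟩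
  rw [reducedComplexity_Ico d huv, psi_zsqrtdVal hd2 hd, psi_zsqrtdVal hd2 hd]
  constructor
  · have h := one_le_abs_zsqrtdVal_sub hd2 hd (le_max_right (zsqrtdHeight w) (zsqrtdHeight z))
      (le_max_left (zsqrtdHeight w) (zsqrtdHeight z)) (by rintro rfl; exact lt_irrefl _ huv)
    rw [abs_of_pos hL] at h
    rw [div_le_iff₀ hs]
    linarith
  · rw [mul_comm, ← le_div_iff₀ hL]
    exact max_le hw hz
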